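/- Let $B:\mathbb{R}\to\mathbb{R}$ be a $C^1$ function that is Lipschitz continuous, monotonically decreasing and convex, with $B(0)=1$, $B(s)>0$ and $\ln B(-s)-\ln B(s)=s$ for all $s\in\mathbb{R}$. Let $u:\mathbb{R}\to\mathbb{R}$ be smooth with $u''(x)\ge\lambda$ for all $x\in\mathbb{R}$, for some constant $\lambda>0$. For $h>0$ and $i\in\mathbb{Z}$ put $u_i=u(ih)$, $$\alpha_i=\frac{1}{h^2}B(u_{i+1}-u_i),\qquad \beta_i=\frac{1}{h^2}B(u_{i-1}-u_i),\qquad \pi_i=\frac{e^{-u_i}}{\sum_{j\in\mathbb{Z}}e^{-u_j}},\qquad \pi^h=(\pi_i)_{i\in\mathbb{Z}}.$$ For $f,g:\mathbb{Z}\to\mathbb{R}$ write $\langle f,g\rangle=\sum_{i\in\mathbb{Z}}f_ig_i$, $(\mathcal{L}_hf)_i=\alpha_i(f_{i+1}-f_i)-\beta_i(f_i-f_{i-1})$, $$\Gamma^h(f,g)=\tfrac12\big(\mathcal{L}_h(fg)-f\mathcal{L}_hg-g\mathcal{L}_hf\big),\qquad |Df|_i=\Big(\tfrac12\alpha_i(f_{i+1}-f_i)^2+\tfrac12\beta_i(f_i-f_{i-1})^2\Big)^{1/2},$$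 and let $\mathcal{H}^1(\pi^h)$ be the set of all $f:\mathbb{Z}\to\mathbb{R}$ with $\sum_i f_i^2\pi_i<\infty$ and $\sum_i|Df|_i^2\pi_i<\infty$. Then there is a constant $\kappa>0$, independent of $h$ (it may depend on $B$ and $u$), such that for every $h>0$ the following holds. The sequence $\pi^h$ is a well-defined stationary probability distribution of the $B$-scheme $$\frac{d}{dt}\rho_i=(\alpha_{i-1}\rho_{i-1}-\beta_i\rho_i)-(\alpha_i\rho_i-\beta_{i+1}\rho_{i+1}),$$ and it satisfies the discrete Poincaré inequality: for all $f\in\mathcal{H}^1(\pi^h)$ the series below converge and $$\sum_{i\in\mathbb{Z}}\Big(f_i-\langle f,\pi^h\rangle\Big)^2\pi_i\le\frac1\kappa\sum_{i\in\mathbb{Z}}|Df|_i^2\,\pi_i,$$ equivalently $$\langle f^2,\pi^h\rangle-\langle f,\pi^h\rangle^2\le\frac1\kappa\,\langle\Gamma^h(f,f),\pi^h\rangle.$$ -/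

import Mathlib

open scoped NNReal ContDiff

/-- The conditions on the weight function of a B-scheme. -/
structure IsBFunction (B : ℝ → ℝ) : Prop where
  contDiff : ContDiff ℝ 1 B
  lipschitz : ∃ K : ℝ≥0, LipschitzWith K B
  map_zero : B 0 = 1
  pos : ∀ s, 0 < B s
  log_sub_log : ∀ s, Real.log (B (-s)) - Real.log (B s) = s
  antitone : Antitone B

namespace BScheme

noncomputable section

/-- The grid points `x_i = i h`. -/
def grid (h : ℝ) (i : ℤ) : ℝ := (i : ℝ) * h

/-- The rate `α_i = h⁻² B(u_{i+1} - u_i)`, where `u_i = u(x_i)`; it equals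
`h⁻² B(ln (π(x_i) / π(x_{i+1})))` for `π` proportional to `e^{-u}`. -/
def alpha (B u : ℝ → ℝ) (h : ℝ) (i : ℤ) : ℝ :=
  1 / h ^ 2 * B (u (grid h (i + 1)) - u (grid h i))

/-- The rate `β_i = h⁻² B(u_{i-1} - u_i)`. -/
def beta (B u : ℝ → ℝ) (h : ℝ) (i : ℤ) : ℝ :=
  1 / h ^ 2 * B (u (grid h (i - 1)) - u (grid h i))

/-- The forward operator `L_h^*` of the scheme. -/
def forwardOp (B u : ℝ → ℝ) (h : ℝ) (ρ : ℤ → ℝ) (i : ℤ) : ℝ :=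
  (alpha B u h (i - 1) * ρ (i - 1) - beta B u h i * ρ i)
    - (alpha B u h i * ρ i - beta B u h (i + 1) * ρ (i + 1))

/-- The backward operator `L_h` of the scheme. -/
def backwardOp (B u : ℝ → ℝ) (h : ℝ) (f : ℤ → ℝ) (i : ℤ) : ℝ :=
  alpha B u h i * (f (i + 1) - f i) - beta B u h i * (f i - f (i - 1))

/-- `p` is a stationary probability distribution of the scheme. -/
def IsStationaryDistribution (B u : ℝ → ℝ) (h : ℝ) (p : ℤ → ℝ) : Prop :=
  (∀ i, 0 ≤ p i) ∧ HasSum p 1 ∧ ∀ i, forwardOp B u h p i = 0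

/-- The distribution `π^h`: the values of `π ∝ e^{-u}` at the grid points, normalised to sum `1`.
(The normalising constant of `π` itself cancels.) -/
def piH (u : ℝ → ℝ) (h : ℝ) (i : ℤ) : ℝ :=
  Real.exp (-u (grid h i)) / ∑' j : ℤ, Real.exp (-u (grid h j))

/-- The pairing `⟨f, g⟩ = ∑ f_i g_i`. -/
def pairing (f g : ℤ → ℝ) : ℝ := ∑' i : ℤ, f i * g i

/-- The carré du champ operator `Γ^h(f, g) = ½ (L_h(f g) - f L_h g - g L_h f)`. -/
def Gam (B u : ℝ → ℝ) (h : ℝ) (f g : ℤ → ℝ) (i : ℤ) : ℝ :=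
  1 / 2 * (backwardOp B u h (fun j => f j * g j) i
    - f i * backwardOp B u h g i - g i * backwardOp B u h f i)

/-- The modulus `|Df|` of the discrete gradient. -/
def gradNorm (B u : ℝ → ℝ) (h : ℝ) (f : ℤ → ℝ) (i : ℤ) : ℝ :=
  Real.sqrt (1 / 2 * alpha B u h i * (f (i + 1) - f i) ^ 2
    + 1 / 2 * beta B u h i * (f i - f (i - 1)) ^ 2)

/-- The space `H¹(π^h)`: both `f` and `|Df|` lie in `ℓ²(π^h)`. -/
def H1 (B u : ℝ → ℝ) (h : ℝ) : Set (ℤ → ℝ) :=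
  {f | Summable (fun i => f i ^ 2 * piH u h i) ∧
    Summable (fun i => gradNorm B u h f i ^ 2 * piH u h i)}

end

end BScheme

/-!
Write `u_i = u (i h)`, `s_i = u_{i+1} - u_i` and `c_i = α_i π_i`. The identity
`B (-s) = exp s * B s` is detailed balance: `β_i π_i = c_{i-1}` (`BScheme.detailed_balance`). Hence
`π^h` is stationary, the Dirichlet form is `∑ c_i (f_{i+1} - f_i)²`, and the drift
`b_i = β_i - α_i` satisfies the telescoping relation `b_i π_i = c_{i-1} - c_i`.

**A drift gap gives the Poincaré inequality.** Suppose `κ ≤ b_{i+1} - b_i` for all `i`. For `i < j`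
the Cauchy-Schwarz inequality gives
`κ (f_j - f_i)² ≤ κ (j - i) ∑_{i ≤ k < j} (f_{k+1} - f_k)² ≤ (b_j - b_i) ∑_{i ≤ k < j} …`.
Multiply by `π_i π_j` and sum over the pairs in a finite window `[m, n]`. The left side becomes
`κ` times a variance, and on the right the coefficient of `(f_{k+1} - f_k)²` is
`∑_{m ≤ i ≤ k < j ≤ n} π_i π_j (b_j - b_i)`. By telescoping
`∑_{k < j ≤ n} b_j π_j = c_k - c_n ≤ c_k` and `-∑_{m ≤ i ≤ k} b_i π_i = c_k - c_{m-1} ≤ c_k`, so this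
coefficient is at most `c_k ∑_{[m, n]} π_i` (`BScheme.window_poincare`). Working in a window avoids
any interchange of infinite sums; the theorem follows by letting the window exhaust `ℤ`.

**The drift gap is uniform in `h`** (`BScheme.exists_drift_gap`). One has
`h² (b_{i+1} - b_i) = B(s_i) - B(s_{i+1}) + B(-s_i) - B(-s_{i-1})`, where consecutive `s_i` differ by
at least `d = λ h²`. Since one of `s_i`, `-s_i` is nonpositive, convexity bounds this below by
`B(0) - B(d)`, which is of order `d` as long as `h` is bounded, because `B'(0) = -1/2`. For
large `h` that bound is too weak. But then `|s_i| ≥ d / 4` for every `i`, and the slope of `B` on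
`(-∞, 0]` is at most `-1/2`, which gives the bound `d / 8`.
-/

open Finset Filter Topology

namespace BScheme

/-! ### Convex functions on the line -/

/-- The increments `f (x + d) - f x` of a convex function are monotone in `x`. -/
theorem add_le_add_of_convexOn {B : ℝ → ℝ} (hB : ConvexOn ℝ Set.univ B) {x y d : ℝ}
    (hxy : x ≤ y) (hd : 0 ≤ d) : B y + B (x + d) ≤ B x + B (y + d) := by
  rcases hd.eq_or_lt with rfl | hd
  · simp [add_comm]
  have hpos : 0 < y + d - x := by linarith
  have hsum : d / (y + d - x) + (y - x) / (y + d - x) = 1 := by field_simp; ring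
  have h1 := hB.2 (Set.mem_univ x) (Set.mem_univ (y + d))
    (show 0 ≤ d / (y + d - x) by positivity)
    (show 0 ≤ (y - x) / (y + d - x) from div_nonneg (by linarith) hpos.le) hsum
  have h2 := hB.2 (Set.mem_univ x) (Set.mem_univ (y + d))
    (show 0 ≤ (y - x) / (y + d - x) from div_nonneg (by linarith) hpos.le)
    (show 0 ≤ d / (y + d - x) by positivity) ((add_comm _ _).trans hsum)
  have e1 : d / (y + d - x) * x + (y - x) / (y + d - x) * (y + d) = y := by field_simp; ring
  have e2 : (y - x) / (y + d - x) * x + d / (y + d - x) * (y + d) = x + d := by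
    field_simp; ring
  simp only [smul_eq_mul, e1, e2] at h1 h2
  have e3 : (d / (y + d - x) * B x + (y - x) / (y + d - x) * B (y + d))
      + ((y - x) / (y + d - x) * B x + d / (y + d - x) * B (y + d)) = B x + B (y + d) := by
    linear_combination (B x + B (y + d)) * hsum
  linarith

theorem tangent_le_of_convexOn {f : ℝ → ℝ} (hf : ConvexOn ℝ Set.univ f) {f' x : ℝ}
    (hd : HasDerivAt f f' x) (y : ℝ) : f x + f' * (y - x) ≤ f y := by
  rcases lt_trichotomy x y with h | rfl | h
  · have := hf.le_slope_of_hasDerivAt (Set.mem_univ _) (Set.mem_univ _) h hd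
    rw [slope_def_field, le_div_iff₀ (by linarith)] at this
    linarith
  · simp
  · have := hf.slope_le_of_hasDerivAt (Set.mem_univ _) (Set.mem_univ _) h hd
    rw [slope_def_field, div_le_iff₀ (by linarith)] at this
    linarith

/-! ### The weight function -/

section WeightFunction

variable {B : ℝ → ℝ}

theorem map_neg_eq (hB : IsBFunction B) (s : ℝ) : B (-s) = Real.exp s * B s := by
  have h := congrArg Real.exp (hB.log_sub_log s)
  rw [Real.exp_sub, Real.exp_log (hB.pos _), Real.exp_log (hB.pos _),
    div_eq_iff (hB.pos _).ne'] at h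
  exact h

/-- Differentiating `B (-s) = exp s * B s` at `s = 0` determines the slope of `B` there. -/
theorem hasDerivAt_zero (hB : IsBFunction B) : HasDerivAt B (-1 / 2) 0 := by
  have h0 : HasDerivAt B (deriv B 0) 0 :=
    (hB.contDiff.differentiable one_ne_zero 0).hasDerivAt
  have h1 : HasDerivAt (fun s => B (-s)) (-deriv B 0) 0 := by
    have h0' : HasDerivAt B (deriv B 0) (-0) := by simpa using h0
    exact (h0'.comp (0 : ℝ) (hasDerivAt_neg (0 : ℝ))).congr_deriv (by ring)
  have h2 : HasDerivAt (fun s => Real.exp s * B s) (1 + deriv B 0) 0 := by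
    exact ((Real.hasDerivAt_exp 0).mul h0).congr_deriv (by simp [hB.map_zero])
  rw [funext (map_neg_eq hB)] at h1
  have h3 := h1.unique h2
  rwa [show deriv B 0 = -1 / 2 by linarith] at h0

theorem map_lt_one (hB : IsBFunction B) {d : ℝ} (hd : 0 < d) : B d < 1 := by
  refine lt_of_le_of_ne (hB.map_zero ▸ hB.antitone hd.le) fun h1 => ?_
  -- otherwise `B` is constant on `[0, d]`, so its right derivative at `0` vanishes
  have hc : ∀ x ∈ Set.Icc 0 d, B x = 1 := fun x hx =>
    le_antisymm (hB.map_zero ▸ hB.antitone hx.1) (h1 ▸ hB.antitone hx.2)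
  have hw : HasDerivWithinAt B 0 (Set.Icc 0 d) 0 :=
    (hasDerivWithinAt_const (0 : ℝ) (Set.Icc 0 d) (1 : ℝ)).congr hc hB.map_zero
  have := (uniqueDiffOn_Icc hd 0 (Set.left_mem_Icc.2 hd.le)).eq_deriv _ hw
    (hasDerivAt_zero hB).hasDerivWithinAt
  norm_num at this

/-- On `(-∞, 0]` the convex function `B` has slope at most `B'(0) = -1/2`. -/
theorem half_le_decrement (hB : IsBFunction B) (hBc : ConvexOn ℝ Set.univ B) {x d : ℝ}
    (hd : 0 ≤ d) (hx : x + d ≤ 0) : d / 2 ≤ B x - B (x + d) := by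
  have h1 := add_le_add_of_convexOn hBc (show x ≤ -d by linarith) hd
  have h2 := tangent_le_of_convexOn hBc (hasDerivAt_zero hB) (-d)
  rw [hB.map_zero] at h2
  rw [neg_add_cancel, hB.map_zero] at h1
  linarith

/-- On bounded intervals `[0, D]`, the decrement of `B` from `0` is at least linear. -/
theorem mul_le_one_sub_map (hB : IsBFunction B) (hBc : ConvexOn ℝ Set.univ B) {d D : ℝ}
    (hd : 0 < d) (hdD : d ≤ D) : (1 - B D) / D * d ≤ 1 - B d := by
  have hD : 0 < D := hd.trans_le hdD
  have h := hBc.2 (Set.mem_univ 0) (Set.mem_univ D) 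
    (show 0 ≤ 1 - d / D from sub_nonneg.2 ((div_le_one hD).2 hdD))
    (show 0 ≤ d / D by positivity) (by ring)
  simp only [smul_eq_mul, mul_zero, zero_add, div_mul_cancel₀ d hD.ne', hB.map_zero] at h
  have e : (1 - B D) / D * d = d / D - d / D * B D := by ring
  linarith

/-- Lower bound for the drift increment in terms of three successive increments `r`, `s`, `t` of the
potential, suited to small meshes. The case `s ≤ 0` follows on replacing `(r, s, t)` by
`(-t, -s, -r)`. -/
theorem one_sub_map_le_of_nonneg (hB : IsBFunction B) (hBc : ConvexOn ℝ Set.univ B)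
    {r s t d : ℝ} (hd : 0 ≤ d) (hs : 0 ≤ s) (hrs : d ≤ s - r) (hst : d ≤ t - s) :
    1 - B d ≤ B s - B t + B (-s) - B (-r) := by
  have h1 : B t ≤ B s := hB.antitone (by linarith)
  have h2 : B (-r) ≤ B (-s + d) := hB.antitone (by linarith)
  have h3 := add_le_add_of_convexOn hBc (show -s ≤ 0 by linarith) hd
  rw [hB.map_zero, zero_add] at h3
  linarith

/-- Companion of `one_sub_map_le_of_nonneg` for large meshes, where `s` is bounded away from `0`. -/
theorem eighth_le_of_quarter_le (hB : IsBFunction B) (hBc : ConvexOn ℝ Set.univ B)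
    {r s t d : ℝ} (hd : 0 ≤ d) (hs : d / 4 ≤ s) (hrs : d ≤ s - r) (hst : d ≤ t - s) :
    d / 8 ≤ B s - B t + B (-s) - B (-r) := by
  have h1 : B t ≤ B s := hB.antitone (by linarith)
  have h2 : B (-r) ≤ B (-s + d / 4) := hB.antitone (by linarith)
  have h3 := half_le_decrement hB hBc (x := -s) (d := d / 4) (by linarith) (by linarith)
  linarith

end WeightFunction

/-! ### Increments of the potential along the grid -/

section Potential

variable {u : ℝ → ℝ} {lam : ℝ}

theorem convexOn_sub_sq (hu : ContDiff ℝ ∞ u) (hu2 : ∀ x, lam ≤ deriv (deriv u) x) :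
    ConvexOn ℝ Set.univ (fun x => u x - lam / 2 * x ^ 2) := by
  have hd : Differentiable ℝ u := hu.differentiable (by simp)
  have hd' : Differentiable ℝ (deriv u) :=
    ((contDiff_infty_iff_deriv.1 hu).2).differentiable (by simp)
  have e1 : ∀ x, HasDerivAt (fun x => u x - lam / 2 * x ^ 2) (deriv u x - lam * x) x := by
    intro x
    have h := (hd x).hasDerivAt.sub (((hasDerivAt_id x).pow 2).const_mul (lam / 2))
    refine h.congr_deriv ?_
    simp
    ring
  have e1' : deriv (fun x => u x - lam / 2 * x ^ 2) = fun x => deriv u x - lam * x :=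
    funext fun x => (e1 x).deriv
  have e2 : ∀ x, HasDerivAt (fun x => deriv u x - lam * x) (deriv (deriv u) x - lam) x := by
    intro x
    exact ((hd' x).hasDerivAt.sub ((hasDerivAt_id x).const_mul lam)).congr_deriv (by simp)
  refine convexOn_univ_of_deriv2_nonneg (fun x => (e1 x).differentiableAt) ?_ fun x => ?_
  · rw [e1']
    exact fun x => (e2 x).differentiableAt
  · simp only [Function.iterate_succ, Function.iterate_zero, Function.comp_apply, id]
    rw [e1', (e2 x).deriv]
    linarith [hu2 x]

theorem quadratic_le (hu : ContDiff ℝ ∞ u) (hu2 : ∀ x, lam ≤ deriv (deriv u) x) (x : ℝ) :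
    u 0 + deriv u 0 * x + lam / 2 * x ^ 2 ≤ u x := by
  have hd : HasDerivAt (fun x => u x - lam / 2 * x ^ 2) (deriv u 0) 0 := by
    have h := ((hu.differentiable (by simp)) 0).hasDerivAt.sub
      (((hasDerivAt_id (0 : ℝ)).pow 2).const_mul (lam / 2))
    refine h.congr_deriv ?_
    simp
  have := tangent_le_of_convexOn (convexOn_sub_sq hu hu2) hd x
  simp only [sub_zero] at this
  linarith

theorem second_difference_ge (hu : ContDiff ℝ ∞ u) (hu2 : ∀ x, lam ≤ deriv (deriv u) x)
    {h : ℝ} (hh : 0 < h) (i : ℤ) :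
    lam * h ^ 2 ≤ (u (grid h (i + 1)) - u (grid h i)) - (u (grid h i) - u (grid h (i - 1))) := by
  have := add_le_add_of_convexOn (convexOn_sub_sq hu hu2)
    (show grid h (i - 1) ≤ grid h i by simp only [grid]; push_cast; nlinarith) hh.le
  have e1 : grid h (i - 1) + h = grid h i := by simp only [grid]; push_cast; ring
  have e2 : grid h i + h = grid h (i + 1) := by simp only [grid]; push_cast; ring
  rw [e1, e2] at this
  have e3 : grid h (i - 1) = grid h i - h := by rw [← e1]; ring
  have e4 : grid h (i + 1) = grid h i + h := e2.symm
  have e5 : lam / 2 * grid h (i + 1) ^ 2 + lam / 2 * grid h (i - 1) ^ 2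
      - 2 * (lam / 2 * grid h i ^ 2) = lam * h ^ 2 := by rw [e3, e4]; ring
  linarith

theorem difference_mono (hlam : 0 < lam) (hu : ContDiff ℝ ∞ u)
    (hu2 : ∀ x, lam ≤ deriv (deriv u) x) {h : ℝ} (hh : 0 < h) :
    Monotone fun i : ℤ => u (grid h (i + 1)) - u (grid h i) := by
  refine monotone_int_of_le_succ fun i => ?_
  have h1 := second_difference_ge hu hu2 hh (i + 1)
  rw [add_sub_cancel_right] at h1
  have : 0 < lam * h ^ 2 := by positivity
  linarith

/-- For a large mesh size the increments of `u` along the grid stay away from zero, because the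
minimiser of `u` is then close to the grid point `0` on the scale of `h`. -/
theorem difference_ge_or_le (hlam : 0 < lam) (hu : ContDiff ℝ ∞ u)
    (hu2 : ∀ x, lam ≤ deriv (deriv u) x) {h : ℝ} (hh : 0 < h)
    (hlarge : |deriv u 0| ≤ lam * h / 4) (i : ℤ) :
    lam * h ^ 2 / 4 ≤ u (grid h (i + 1)) - u (grid h i) ∨
      u (grid h (i + 1)) - u (grid h i) ≤ -(lam * h ^ 2 / 4) := by
  have hm := difference_mono hlam hu hu2 hh
  obtain ⟨ha, hb⟩ := abs_le.1 hlarge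
  rcases le_or_gt 0 i with hi | hi
  · left
    refine le_trans ?_ (hm hi)
    have := quadratic_le hu hu2 h
    simp only [grid, zero_add, Int.cast_one, one_mul, Int.cast_zero, zero_mul]
    nlinarith
  · right
    refine (hm (show i ≤ -1 by omega)).trans ?_
    have := quadratic_le hu hu2 (-h)
    simp only [grid, neg_add_cancel, Int.cast_neg, Int.cast_one, Int.cast_zero, zero_mul,
      neg_mul, one_mul]
    nlinarith

theorem summable_exp_neg (hlam : 0 < lam) (hu : ContDiff ℝ ∞ u)
    (hu2 : ∀ x, lam ≤ deriv (deriv u) x) {h : ℝ} (hh : 0 < h) :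
    Summable fun i : ℤ => Real.exp (-u (grid h i)) := by
  -- `K` is the maximum of `-u 0 + (1 + |u'(0)|) r - λ r² / 2` over `r`
  set K := -u 0 + (1 + |deriv u 0|) ^ 2 / (2 * lam)
  have hK : ∀ x, -u x ≤ K - |x| := by
    intro x
    have h1 := quadratic_le hu hu2 x
    have h2 : -(|deriv u 0| * |x|) ≤ deriv u 0 * x := by
      rw [← abs_mul]; exact neg_abs_le _
    have h3 : (1 + |deriv u 0|) * |x| ≤ (1 + |deriv u 0|) ^ 2 / (2 * lam) + lam / 2 * x ^ 2 := by
      rw [← sq_abs x]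
      have : (1 + |deriv u 0|) ^ 2 / (2 * lam) + lam / 2 * |x| ^ 2 - (1 + |deriv u 0|) * |x|
          = (1 + |deriv u 0| - lam * |x|) ^ 2 / (2 * lam) := by field_simp; ring
      have : 0 ≤ (1 + |deriv u 0| - lam * |x|) ^ 2 / (2 * lam) := by positivity
      linarith
    simp only [K]
    linarith
  have hgeo : Summable fun n : ℕ => Real.exp K * Real.exp (-h) ^ n :=
    (summable_geometric_of_lt_one (Real.exp_pos _).le (by simpa using hh)).mul_left _
  have key : ∀ (n : ℕ) (i : ℤ), |(i : ℝ)| = n →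
      Real.exp (-u (grid h i)) ≤ Real.exp K * Real.exp (-h) ^ n := by
    intro n i hi
    rw [← Real.exp_nat_mul, ← Real.exp_add, Real.exp_le_exp]
    refine (hK _).trans (le_of_eq ?_)
    rw [grid, abs_mul, hi, abs_of_pos hh]
    ring
  refine Summable.of_nat_of_neg ?_ ?_
  · exact Summable.of_nonneg_of_le (fun _ => (Real.exp_pos _).le)
      (fun n => key n n (by simp)) hgeo
  · exact Summable.of_nonneg_of_le (fun _ => (Real.exp_pos _).le)
      (fun n => key n (-n) (by simp)) hgeo

end Potential

/-! ### The drift gap -/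

/-- The drift `β - α` increases by at least `κ` at each step, with `κ` independent of `h`. -/
theorem exists_drift_gap {B u : ℝ → ℝ} (hB : IsBFunction B) (hBc : ConvexOn ℝ Set.univ B)
    (hu : ContDiff ℝ ∞ u) {lam : ℝ} (hlam : 0 < lam) (hu2 : ∀ x, lam ≤ deriv (deriv u) x) :
    ∃ κ : ℝ, 0 < κ ∧ ∀ h : ℝ, 0 < h → ∀ i : ℤ,
      κ ≤ (beta B u h (i + 1) - alpha B u h (i + 1)) - (beta B u h i - alpha B u h i) := by
  -- `H` separates small meshes from those for which `difference_ge_or_le` applies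
  set H := 4 * |deriv u 0| / lam + 1
  have hH : 0 < H := by positivity
  set D := lam * H ^ 2
  have hD : 0 < D := by positivity
  have hBD : 0 < 1 - B D := sub_pos.2 (map_lt_one hB hD)
  refine ⟨lam * min (1 / 8) ((1 - B D) / D), by positivity, fun h hh i => ?_⟩
  have hd : 0 < lam * h ^ 2 := by positivity
  set r := u (grid h i) - u (grid h (i - 1)) with hr
  set s := u (grid h (i + 1)) - u (grid h i) with hs
  set t := u (grid h (i + 1 + 1)) - u (grid h (i + 1)) with ht
  have hrs : lam * h ^ 2 ≤ s - r := second_difference_ge hu hu2 hh i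
  have hst : lam * h ^ 2 ≤ t - s := by
    have := second_difference_ge hu hu2 hh (i + 1)
    rwa [add_sub_cancel_right] at this
  have hexp : (beta B u h (i + 1) - alpha B u h (i + 1)) - (beta B u h i - alpha B u h i)
      = (B s - B t + B (-s) - B (-r)) / h ^ 2 := by
    simp only [alpha, beta, hr, hs, ht, neg_sub, add_sub_cancel_right]
    ring
  rw [hexp, le_div_iff₀ (by positivity)]
  -- reflection `i ↦ -i`
  have hsymm : B s - B t + B (-s) - B (-r) = B (-s) - B (-r) + B (- -s) - B (- -t) := by
    simp only [neg_neg]; ring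
  rcases le_total h H with hle | hle
  · have h1 : 1 - B (lam * h ^ 2) ≤ B s - B t + B (-s) - B (-r) := by
      rcases le_total 0 s with h0 | h0
      · exact one_sub_map_le_of_nonneg hB hBc hd.le h0 hrs hst
      · rw [hsymm]
        exact one_sub_map_le_of_nonneg hB hBc hd.le (by linarith) (by linarith) (by linarith)
    have h2 : (1 - B D) / D * (lam * h ^ 2) ≤ 1 - B (lam * h ^ 2) :=
      mul_le_one_sub_map hB hBc hd (by simp only [D]; gcongr)
    have h3 : min (1 / 8) ((1 - B D) / D) * (lam * h ^ 2) ≤ (1 - B D) / D * (lam * h ^ 2) :=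
      mul_le_mul_of_nonneg_right (min_le_right _ _) hd.le
    linarith
  · have h1 : lam * h ^ 2 / 8 ≤ B s - B t + B (-s) - B (-r) := by
      have hlarge : |deriv u 0| ≤ lam * h / 4 := by
        have : 4 * |deriv u 0| / lam ≤ h := by simp only [H] at hle; linarith
        rw [div_le_iff₀ hlam] at this
        linarith
      rcases difference_ge_or_le hlam hu hu2 hh hlarge i with h0 | h0
      · exact eighth_le_of_quarter_le hB hBc hd.le h0 hrs hst
      · rw [hsymm]
        exact eighth_le_of_quarter_le hB hBc hd.le (by linarith) (by linarith) (by linarith)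
    have h3 : min (1 / 8) ((1 - B D) / D) * (lam * h ^ 2) ≤ 1 / 8 * (lam * h ^ 2) :=
      mul_le_mul_of_nonneg_right (min_le_left _ _) hd.le
    linarith

/-! ### The Poincaré inequality on a finite window -/

section Window

theorem sum_Ioc_sub_pred (c : ℤ → ℝ) {m n : ℤ} (hmn : m ≤ n) :
    ∑ i ∈ Ioc m n, (c (i - 1) - c i) = c m - c n := by
  induction n, hmn using Int.leInduction with
  | base => simp
  | succ n hn ih =>
    rw [← Order.succ_eq_add_one, ← insert_Ioc_right_eq_Ioc_succ hn, sum_insert (by simp), ih,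
      Order.succ_eq_add_one, add_sub_cancel_right]
    ring

theorem sq_sub_le_mul_sum {κ : ℝ} (hκ : 0 ≤ κ) {b : ℤ → ℝ}
    (hb : ∀ i, κ ≤ b (i + 1) - b i) (f : ℤ → ℝ) {i j : ℤ} (hij : i ≤ j) :
    κ * (f j - f i) ^ 2 ≤ (b j - b i) * ∑ k ∈ Ico i j, (f (k + 1) - f k) ^ 2 := by
  have tele : ∀ c : ℤ → ℝ, c j - c i = ∑ k ∈ Ico i j, (c (k + 1) - c k) := by
    intro c
    induction j, hij using Int.leInduction with
    | base => simp
    | succ n hn ih =>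
      rw [← Order.succ_eq_add_one, ← insert_Ico_right_eq_Ico_succ hn, sum_insert (by simp), ← ih,
        Order.succ_eq_add_one]
      ring
  have hcard : κ * #(Ico i j) ≤ b j - b i := by
    rw [tele b, mul_comm, ← nsmul_eq_mul]
    exact card_nsmul_le_sum _ _ _ fun k _ => hb k
  have hcs : (f j - f i) ^ 2 ≤ #(Ico i j) * ∑ k ∈ Ico i j, (f (k + 1) - f k) ^ 2 := by
    rw [tele f]
    exact sq_sum_le_card_mul_sum_sq
  have h0 : 0 ≤ ∑ k ∈ Ico i j, (f (k + 1) - f k) ^ 2 := sum_nonneg fun _ _ => sq_nonneg _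
  calc κ * (f j - f i) ^ 2 ≤ κ * (#(Ico i j) * ∑ k ∈ Ico i j, (f (k + 1) - f k) ^ 2) := by gcongr
    _ = κ * #(Ico i j) * ∑ k ∈ Ico i j, (f (k + 1) - f k) ^ 2 := by ring
    _ ≤ _ := by gcongr

/-- Poincaré inequality on a window for a nonnegative weight `p`, where `c` plays the role of the
conductances `α p` and `b` that of the drift. The boundary fluxes `c (m - 1)` and `c n` enter
with a favourable sign, so that the window needs no boundary condition. -/
theorem window_poincare {κ : ℝ} (hκ : 0 ≤ κ) {b c p : ℤ → ℝ} (hb : ∀ i, κ ≤ b (i + 1) - b i)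
    (hc : ∀ i, 0 ≤ c i) (hp : ∀ i, 0 ≤ p i) (hbc : ∀ i, b i * p i = c (i - 1) - c i)
    (f : ℤ → ℝ) (m n : ℤ) :
    κ * ((∑ i ∈ Icc m n, p i) * (∑ i ∈ Icc m n, f i ^ 2 * p i) - (∑ i ∈ Icc m n, f i * p i) ^ 2)
      ≤ (∑ i ∈ Icc m n, p i) * ∑ k ∈ Icc m n, c k * (f (k + 1) - f k) ^ 2 := by
  set P := Icc m n with hP
  set S : ℤ → ℤ → ℝ := fun i j => ∑ k ∈ Ico i j, (f (k + 1) - f k) ^ 2 with hS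
  -- symmetric in `i` and `j`: one of the two sums is empty
  have hpair : ∀ i j, κ * (f i - f j) ^ 2 ≤ (b j - b i) * S i j + (b i - b j) * S j i := by
    intro i j
    rcases le_total i j with h | h
    · have := sq_sub_le_mul_sum hκ hb f h
      simp only [hS, Ico_eq_empty (not_lt.2 h), sum_empty]
      linarith [show (f i - f j) ^ 2 = (f j - f i) ^ 2 by ring]
    · have := sq_sub_le_mul_sum hκ hb f h
      simp only [hS, Ico_eq_empty (not_lt.2 h), sum_empty]
      linarith
  have hvar : ∑ i ∈ P, ∑ j ∈ P, p i * p j * (f i - f j) ^ 2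
      = 2 * ((∑ i ∈ P, p i) * (∑ i ∈ P, f i ^ 2 * p i) - (∑ i ∈ P, f i * p i) ^ 2) := by
    have e : ∀ i j, p i * p j * (f i - f j) ^ 2
        = (f i ^ 2 * p i) * p j + p i * (f j ^ 2 * p j) - 2 * ((f i * p i) * (f j * p j)) :=
      fun i j => by ring
    simp only [e, sum_sub_distrib, sum_add_distrib, ← mul_sum, ← sum_mul]
    ring
  set A := ∑ i ∈ P, ∑ j ∈ P, p i * p j * ((b j - b i) * S i j) with hA
  have hle : κ * ((∑ i ∈ P, p i) * (∑ i ∈ P, f i ^ 2 * p i) - (∑ i ∈ P, f i * p i) ^ 2) ≤ A := by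
    have h2 : ∑ i ∈ P, ∑ j ∈ P, p i * p j * ((b i - b j) * S j i) = A := by
      rw [sum_comm]
      exact sum_congr rfl fun i _ => sum_congr rfl fun j _ => by ring
    have h1 : κ * ∑ i ∈ P, ∑ j ∈ P, p i * p j * (f i - f j) ^ 2 ≤ A + A :=
      calc κ * ∑ i ∈ P, ∑ j ∈ P, p i * p j * (f i - f j) ^ 2
          = ∑ i ∈ P, ∑ j ∈ P, κ * (p i * p j * (f i - f j) ^ 2) := by simp only [mul_sum]
        _ ≤ ∑ i ∈ P, ∑ j ∈ P,
            (p i * p j * ((b j - b i) * S i j) + p i * p j * ((b i - b j) * S j i)) := by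
          refine sum_le_sum fun i _ => sum_le_sum fun j _ => ?_
          have := mul_le_mul_of_nonneg_left (hpair i j) (mul_nonneg (hp i) (hp j))
          linarith
        _ = A + A := by
          simp only [sum_add_distrib]
          rw [h2]
    rw [hvar] at h1
    linarith
  refine hle.trans ?_
  have hAk : A = ∑ k ∈ P, (f (k + 1) - f k) ^ 2 *
      ∑ i ∈ Icc m k, ∑ j ∈ Ioc k n, p i * p j * (b j - b i) := by
    have hSij : ∀ i ∈ P, ∀ j ∈ P, S i j
        = ∑ k ∈ P, if i ≤ k ∧ k < j then (f (k + 1) - f k) ^ 2 else 0 := by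
      intro i hi j hj
      rw [← sum_filter]
      refine sum_congr ?_ fun _ _ => rfl
      ext k
      simp only [hP, mem_Icc, mem_Ico, mem_filter] at hi hj ⊢
      omega
    have h1 : A = ∑ i ∈ P, ∑ j ∈ P, ∑ k ∈ P,
        if i ≤ k ∧ k < j then p i * p j * (b j - b i) * (f (k + 1) - f k) ^ 2 else 0 := by
      refine sum_congr rfl fun i hi => sum_congr rfl fun j hj => ?_
      rw [hSij i hi j hj, ← mul_assoc, mul_sum]
      simp only [mul_ite, mul_zero]
    have h2 : ∀ i, (∑ j ∈ P, ∑ k ∈ P,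
        if i ≤ k ∧ k < j then p i * p j * (b j - b i) * (f (k + 1) - f k) ^ 2 else 0)
        = ∑ k ∈ P, ∑ j ∈ P,
        if i ≤ k ∧ k < j then p i * p j * (b j - b i) * (f (k + 1) - f k) ^ 2 else 0 :=
      fun i => sum_comm
    simp only [h1, h2]
    rw [sum_comm]
    refine sum_congr rfl fun k hk => ?_
    have e1 : Icc m k = P.filter (· ≤ k) := by
      ext i; simp only [hP, mem_Icc, mem_filter] at hk ⊢; omega
    have e2 : Ioc k n = P.filter (k < ·) := by
      ext i; simp only [hP, mem_Icc, mem_Ioc, mem_filter] at hk ⊢; omega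
    rw [e1, e2, sum_filter, mul_sum]
    refine sum_congr rfl fun i _ => ?_
    by_cases hik : i ≤ k
    · simp only [hik, true_and, if_true, sum_filter, mul_sum]
      refine sum_congr rfl fun j _ => ?_
      split_ifs <;> ring
    · simp [hik]
  rw [hAk, mul_sum]
  refine sum_le_sum fun k hk => ?_
  have hk' := mem_Icc.1 hk
  have hsplit : ∑ i ∈ P, p i = ∑ i ∈ Icc m k, p i + ∑ i ∈ Ioc k n, p i := by
    rw [← sum_union]
    · refine sum_congr ?_ fun _ _ => rfl
      ext i; simp only [hP, mem_Icc, mem_Ioc, mem_union]; omega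
    · rw [disjoint_left]; intro i; simp only [mem_Icc, mem_Ioc]; omega
  have hright : ∑ j ∈ Ioc k n, b j * p j ≤ c k := by
    simp only [hbc, sum_Ioc_sub_pred c hk'.2]
    linarith [hc n]
  have hleft : -c k ≤ ∑ i ∈ Icc m k, b i * p i := by
    have e : Icc m k = Ioc (m - 1) k := by ext i; simp only [mem_Icc, mem_Ioc]; omega
    simp only [hbc, e, sum_Ioc_sub_pred c (show m - 1 ≤ k by omega)]
    linarith [hc (m - 1)]
  have hF : 0 ≤ ∑ i ∈ Icc m k, p i := sum_nonneg fun i _ => hp i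
  have hG : 0 ≤ ∑ i ∈ Ioc k n, p i := sum_nonneg fun i _ => hp i
  have hdouble : ∑ i ∈ Icc m k, ∑ j ∈ Ioc k n, p i * p j * (b j - b i)
      = (∑ i ∈ Icc m k, p i) * (∑ j ∈ Ioc k n, b j * p j)
        - (∑ i ∈ Icc m k, b i * p i) * ∑ j ∈ Ioc k n, p j := by
    have e : ∀ i j, p i * p j * (b j - b i) = p i * (b j * p j) - (b i * p i) * p j :=
      fun i j => by ring
    simp only [e, sum_sub_distrib, ← mul_sum, ← sum_mul]
  have hfin : ∑ i ∈ Icc m k, ∑ j ∈ Ioc k n, p i * p j * (b j - b i) ≤ (∑ i ∈ P, p i) * c k := by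
    rw [hdouble, hsplit]
    nlinarith
  calc _ ≤ (f (k + 1) - f k) ^ 2 * ((∑ i ∈ P, p i) * c k) :=
        mul_le_mul_of_nonneg_left hfin (sq_nonneg _)
    _ = _ := by ring

end Window

/-! ### Detailed balance and the Dirichlet form -/

section Scheme

variable {B u : ℝ → ℝ} {h : ℝ}

theorem alpha_nonneg (hB : IsBFunction B) (i : ℤ) : 0 ≤ alpha B u h i :=
  mul_nonneg (by positivity) (hB.pos _).le

theorem beta_nonneg (hB : IsBFunction B) (i : ℤ) : 0 ≤ beta B u h i :=
  mul_nonneg (by positivity) (hB.pos _).le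

theorem piH_nonneg (i : ℤ) : 0 ≤ piH u h i :=
  div_nonneg (Real.exp_pos _).le (tsum_nonneg fun _ => (Real.exp_pos _).le)

theorem hasSum_piH (hs : Summable fun i : ℤ => Real.exp (-u (grid h i))) :
    HasSum (piH u h) 1 := by
  have hpos : 0 < ∑' i : ℤ, Real.exp (-u (grid h i)) :=
    hs.tsum_pos (fun _ => (Real.exp_pos _).le) 0 (Real.exp_pos _)
  have := hs.hasSum.div_const (∑' i : ℤ, Real.exp (-u (grid h i)))
  rwa [div_self hpos.ne'] at this

theorem detailed_balance (hB : IsBFunction B) (i : ℤ) :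
    beta B u h i * piH u h i = alpha B u h (i - 1) * piH u h (i - 1) := by
  have h1 := map_neg_eq hB (u (grid h i) - u (grid h (i - 1)))
  rw [neg_sub, Real.exp_sub] at h1
  simp only [beta, alpha, piH, sub_add_cancel, h1, Real.exp_neg]
  field_simp

theorem forwardOp_piH (hB : IsBFunction B) (i : ℤ) : forwardOp B u h (piH u h) i = 0 := by
  have h1 := detailed_balance (u := u) (h := h) hB i
  have h2 := detailed_balance (u := u) (h := h) hB (i + 1)
  rw [add_sub_cancel_right] at h2
  rw [forwardOp, h1, h2]
  ring

theorem gradNorm_sq (hB : IsBFunction B) (f : ℤ → ℝ) (i : ℤ) :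
    gradNorm B u h f i ^ 2 = 1 / 2 * alpha B u h i * (f (i + 1) - f i) ^ 2
      + 1 / 2 * beta B u h i * (f i - f (i - 1)) ^ 2 := by
  have := alpha_nonneg (u := u) (h := h) hB i
  have := beta_nonneg (u := u) (h := h) hB i
  exact Real.sq_sqrt (by positivity)

theorem Gam_self (hB : IsBFunction B) (f : ℤ → ℝ) :
    Gam B u h f f = fun i => gradNorm B u h f i ^ 2 := by
  funext i
  rw [gradNorm_sq hB, Gam]
  simp only [backwardOp]
  ring

/-- Each bond `{k, k + 1}` contributes half of its energy to `|Df|²` at either endpoint. -/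
theorem sum_energy_le (hB : IsBFunction B) {f : ℤ → ℝ}
    (hf : Summable fun i => gradNorm B u h f i ^ 2 * piH u h i) (s : Finset ℤ) :
    ∑ k ∈ s, alpha B u h k * piH u h k * (f (k + 1) - f k) ^ 2
      ≤ ∑' i, gradNorm B u h f i ^ 2 * piH u h i := by
  set e : ℤ → ℝ := fun k => alpha B u h k * piH u h k * (f (k + 1) - f k) ^ 2
  have he0 : ∀ k, 0 ≤ e k := fun k =>
    mul_nonneg (mul_nonneg (alpha_nonneg hB k) (piH_nonneg k)) (sq_nonneg _)
  have hg : ∀ i, gradNorm B u h f i ^ 2 * piH u h i = 1 / 2 * e i + 1 / 2 * e (i - 1) := by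
    intro i
    rw [gradNorm_sq hB]
    simp only [e, sub_add_cancel]
    linear_combination 1 / 2 * (f i - f (i - 1)) ^ 2 * detailed_balance (u := u) (h := h) hB i
  simp only [hg] at hf ⊢
  have hes : Summable e := by
    refine Summable.of_nonneg_of_le he0 (fun i => ?_) (hf.mul_left 2)
    linarith [he0 (i - 1)]
  have hes' : HasSum (fun i => e (i - 1)) (∑' i, e i) :=
    (Equiv.subRight (1 : ℤ)).hasSum_iff.2 hes.hasSum
  rw [((hes.hasSum.mul_left (1 / 2)).add (hes'.mul_left (1 / 2))).tsum_eq]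
  have := hes.sum_le_tsum s fun i _ => he0 i
  linarith

end Scheme

end BScheme

open BScheme in
theorem theorem1p1 (B u : ℝ → ℝ) (hB : IsBFunction B) (hBconv : ConvexOn ℝ Set.univ B)
    (hu : ContDiff ℝ ∞ u) (lam : ℝ) (hlam : 0 < lam) (hu2 : ∀ x, lam ≤ deriv (deriv u) x) :
    ∃ κ : ℝ, 0 < κ ∧ ∀ h : ℝ, 0 < h →
      BScheme.IsStationaryDistribution B u h (BScheme.piH u h) ∧
      ∀ f ∈ BScheme.H1 B u h,
        -- all the series in the inequalities below converge
        Summable (fun i => f i * BScheme.piH u h i) ∧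
        Summable (fun i => BScheme.Gam B u h f f i * BScheme.piH u h i) ∧
        -- the variance in centred form
        BScheme.pairing (fun i => (f i - BScheme.pairing f (BScheme.piH u h)) ^ 2)
            (BScheme.piH u h)
          ≤ 1 / κ * BScheme.pairing (fun i => BScheme.gradNorm B u h f i ^ 2) (BScheme.piH u h) ∧
        -- the carré du champ form
        BScheme.pairing (fun i => f i ^ 2) (BScheme.piH u h)
            - BScheme.pairing f (BScheme.piH u h) ^ 2
          ≤ 1 / κ * BScheme.pairing (BScheme.Gam B u h f f) (BScheme.piH u h) := by
  obtain ⟨κ, hκ, hgap⟩ := exists_drift_gap hB hBconv hu hlam hu2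
  refine ⟨κ, hκ, fun h hh => ?_⟩
  have hp1 : HasSum (piH u h) 1 := hasSum_piH (summable_exp_neg hlam hu hu2 hh)
  have hp0 : ∀ i, 0 ≤ piH u h i := piH_nonneg
  refine ⟨⟨hp0, hp1, forwardOp_piH hB⟩, fun f hf => ?_⟩
  obtain ⟨hf2, hfE⟩ := hf
  have hf1 : Summable fun i => f i * piH u h i := by
    refine Summable.of_norm_bounded (hf2.add hp1.summable) fun i => ?_
    rw [Real.norm_eq_abs, abs_mul, abs_of_nonneg (hp0 i), ← add_one_mul]
    refine mul_le_mul_of_nonneg_right ?_ (hp0 i)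
    nlinarith [sq_abs (f i), sq_nonneg (|f i| - 1), abs_nonneg (f i)]
  set M := ∑' i, f i * piH u h i with hM
  set Q := ∑' i, f i ^ 2 * piH u h i with hQ
  set E := ∑' i, gradNorm B u h f i ^ 2 * piH u h i with hE
  have hvar : κ * (Q - M ^ 2) ≤ E := by
    have hlim : ∀ {g : ℤ → ℝ} {a : ℝ}, HasSum g a →
        Tendsto (fun N : ℕ => ∑ i ∈ Icc (-(N : ℤ)) N, g i) atTop (𝓝 a) :=
      fun hg => hg.comp tendsto_Icc_neg
    have hS := hlim hp1
    have hL := ((hS.mul (hlim hf2.hasSum)).sub ((hlim hf1.hasSum).pow 2)).const_mul κ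
    have hR := hS.mul_const E
    rw [one_mul] at hL hR
    refine le_of_tendsto_of_tendsto' hL hR fun N => ?_
    refine (window_poincare hκ.le (b := fun i => beta B u h i - alpha B u h i) (hgap h hh)
      (c := fun i => alpha B u h i * piH u h i)
      (fun i => mul_nonneg (alpha_nonneg hB i) (hp0 i)) hp0
      (fun i => ?_) f (-N) N).trans ?_
    · rw [sub_mul, detailed_balance hB]
    · exact mul_le_mul_of_nonneg_left (sum_energy_le hB hfE _) (sum_nonneg fun i _ => hp0 i)
  have hfinal : Q - M ^ 2 ≤ 1 / κ * E := by
    rw [one_div, inv_mul_eq_div, le_div_iff₀ hκ]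
    linarith
  refine ⟨hf1, by rw [Gam_self hB]; exact hfE, ?_, ?_⟩
  · have hcent : HasSum (fun i => (f i - M) ^ 2 * piH u h i) (Q - M ^ 2) := by
      have hsum := (hf2.hasSum.sub (hf1.hasSum.mul_left (2 * M))).add (hp1.mul_left (M ^ 2))
      rw [← hM, ← hQ, show Q - 2 * M * M + M ^ 2 * 1 = Q - M ^ 2 by ring] at hsum
      rwa [show (fun i => (f i - M) ^ 2 * piH u h i) = fun i => f i ^ 2 * piH u h i
        - 2 * M * (f i * piH u h i) + M ^ 2 * piH u h i from funext fun i => by ring]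
    change ∑' i, (f i - M) ^ 2 * piH u h i ≤ 1 / κ * E
    rw [hcent.tsum_eq]
    exact hfinal
  · rw [Gam_self hB]
    exact hfinal
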